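/- **Theorem 3.7.** Let $Q$ be a finitely generated commutative monoid and $\sim$ a congruence on $Q$. *Conventions.* A prime ideal $P\subset Q$ is a (possibly empty) ideal whose complement $Q\smallsetminus P$ is a submonoid; for each $P$ fix a generating set of $P$ as an ideal. Write $Q_P$ for the localization of $Q$ inverting $Q\smallsetminus P$, $P_P$ for the extension of $P$ to $Q_P$, $G_P$ for the unit group of $Q_P$, $\overline Q_P=Q_P/{\sim}$, and $\overline q$ for the image of $q\in Q$ in $\overline Q_P$. Order $\overline Q_P$ by divisibility: $x\preceq y$ if $y\in x+\overline Q_P$; an element $m$ of a subset is maximal in it if $m\preceq y$ implies $y\preceq m$ for every $y$ in the subset. An element $x$ of a monoid is nil if $x+y=x$ for all $y$. *Key witnesses.* $q\in Q$ is a key aide for $w\in Q$ (at $P$) if for every generator $p$ of $P$: $\overline w\neq\overline q$, $\overline w+\overline p=\overline q+\overline p$, and $\overline q$ is maximal in $\{\overline q,\overline w\}$. An element $w$ is a key witness for $P$ if it has a key aide. *Coprincipal components.* For $w\in Q$, the coprincipal component $\sim_w^P$ is the congruence on $Q$ with $a\sim_w^P b$ if and only if either (i) $\overline a\not\preceq\overline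 w$ and $\overline b\not\preceq\overline w$, or (ii) $\overline a,\overline b$ differ by a unit of $\overline Q_P$ and $\overline a+\overline d=\overline b+\overline d=\overline w$ for some $\overline d\in\overline Q_P$. *True witnesses.* For $q\in Q$ let $K_q^P\subseteq G_P$ be the stabilizer of $\overline q$ under the action of $G_P$ on $\overline Q_P$. The $P$-prime congruence at $q$ is the pullback to $Q$ of the congruence on $Q_P$ whose classes are $P_P$ and the cosets of $K_q^P$ in $G_P$. The discrete testimony of $w$ at $P$ is the set of $P$-prime congruences at those $w+p$, $p$ a generator of $P$, for which $\overline{w+p}$ is not nil in $\overline Q_P$; it is suspicious if its common refinement equals the $P$-prime congruence at $w$ (the common refinement of the empty set being the universal congruence). A true witness for $P$ is a key witness $w$ for $P$ such that either (i) $\overline w$ is maximal among the images in $\overline Q_P$ of the key witnesses for $P$, or (ii) the discrete testimony of $w$ at $P$ is not suspicious. *Claim.* 1. $\sim$ is the common refinement (intersection) of the coprincipal components $\sim_w^P$, taken over all primes $P\subset Q$ and all true witnesses $w$ for $P$. 2. If $w$ is a key witness for a prime $P$ but not a true witness for $P$, then $\sim_w^P$ is redundant in the decomposition of $\sim$ into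 the coprincipal components cogenerated by its key witnesses: $\sim$ is the common refinement of all those coprincipal components $\sim_v^{P'}$ ($v$ a key witness for a prime $P'$) that are different from $\sim_w^P$. -/

import Mathlib

namespace Mesoprimary

variable {Q : Type*} [AddCommMonoid Q]

/-- A prime ideal of a commutative monoid `Q`: an ideal (possibly empty) whose complement is a
submonoid of `Q`. -/
structure MonoidPrime (Q : Type*) [AddCommMonoid Q] where
  /-- the underlying monoid ideal -/
  ideal : AddSemigroupIdeal Q
  zero_notMem : (0 : Q) ∉ ideal
  mem_or_mem : ∀ a b : Q, a + b ∈ ideal → a ∈ ideal ∨ b ∈ ideal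

/-- The complement `Q ∖ P`, a submonoid. -/
def MonoidPrime.compl (P : MonoidPrime Q) : AddSubmonoid Q where
  carrier := {a | a ∉ P.ideal}
  zero_mem' := P.zero_notMem
  add_mem' := fun {a b} ha hb hab => (P.mem_or_mem a b hab).elim ha hb

/-- The localization `Q_P`. -/
abbrev MonoidPrime.Loc (P : MonoidPrime Q) : Type _ := AddLocalization P.compl

/-- The canonical morphism `Q → Q_P`. -/
def MonoidPrime.toLoc (P : MonoidPrime Q) : Q →+ P.Loc :=
  (AddLocalization.addMonoidOf P.compl).toAddMonoidHom

/-- The extension `P_P = {p - f : p ∈ P, f ∈ Q ∖ P}` of `P` to `Q_P`. -/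
def MonoidPrime.extIdeal (P : MonoidPrime Q) : Set P.Loc :=
  {x | ∃ p ∈ P.ideal, ∃ f : P.compl, x = AddLocalization.mk p f}

/-- The congruence on `Q_P` generated by the image of a congruence on `Q`. -/
def locCon (c : AddCon Q) (P : MonoidPrime Q) : AddCon P.Loc :=
  addConGen fun x y => ∃ a b : Q, c a b ∧ x = P.toLoc a ∧ y = P.toLoc b

/-- The quotient `Q̄_P = Q_P / ∼`. -/
abbrev LocQuot (c : AddCon Q) (P : MonoidPrime Q) : Type _ := (locCon c P).Quotient

/-- The image of an element of `Q` in `Q̄_P`. -/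
def bar (c : AddCon Q) (P : MonoidPrime Q) : Q →+ LocQuot c P :=
  (locCon c P).mk'.comp P.toLoc

/-- Green's preorder (divisibility): the ideal generated by `x` contains `y`. -/
def GreenLE {M : Type*} [AddCommMonoid M] (x y : M) : Prop := ∃ z, y = x + z

/-- `x` is a nil (absorbing) element. -/
def IsNil {M : Type*} [AddCommMonoid M] (x : M) : Prop := ∀ y, x + y = x

/-- `x` is maximal in the set `T` with respect to Green's preorder. -/
def IsGreenMaximalIn {M : Type*} [AddCommMonoid M] (T : Set M) (x : M) : Prop :=
  x ∈ T ∧ ∀ y ∈ T, GreenLE x y → GreenLE y x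

/-- `S` is a generating set of the prime ideal `P`. -/
def MonoidPrime.IsGeneratedBy (P : MonoidPrime Q) (S : Set Q) : Prop :=
  AddSemigroupIdeal.closure S = P.ideal

/-! In the definitions below, `S` is the chosen generating set of the prime `P`. -/

/-- `q` is an aide for `w` and the generator `p` of `P`. -/
def IsAide (c : AddCon Q) (P : MonoidPrime Q) (w p q : Q) : Prop :=
  bar c P w ≠ bar c P q ∧ bar c P w + bar c P p = bar c P q + bar c P p ∧
    IsGreenMaximalIn {bar c P q, bar c P w} (bar c P q)

/-- `q` is a key aide for `w`. -/
def IsKeyAide (c : AddCon Q) (P : MonoidPrime Q) (S : Set Q) (w q : Q) : Prop :=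
  ∀ p ∈ S, IsAide c P w p q

/-- `w` is a key witness for `P`. -/
def IsKeyWitness (c : AddCon Q) (P : MonoidPrime Q) (S : Set Q) (w : Q) : Prop :=
  ∃ q, IsKeyAide c P S w q

theorem MonoidPrime.isAddUnit_or_mem_extIdeal (P : MonoidPrime Q) (x : P.Loc) :
    IsAddUnit x ∨ x ∈ P.extIdeal := by
  induction x using AddLocalization.induction_on with
  | _ y =>
    obtain ⟨a, f⟩ := y
    by_cases ha : a ∈ P.ideal
    · exact Or.inr ⟨a, ha, f, rfl⟩
    · refine Or.inl (IsAddUnit.of_add_eq_zero (AddLocalization.mk (f : Q) ⟨a, ha⟩) ?_)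
      rw [AddLocalization.mk_add, ← AddLocalization.mk_self (f + ⟨a, ha⟩ : P.compl)]
      congr 1
      exact add_comm _ _

theorem MonoidPrime.not_isAddUnit_of_mem_extIdeal (P : MonoidPrime Q) {x : P.Loc}
    (hx : x ∈ P.extIdeal) : ¬ IsAddUnit x := by
  rintro ⟨u, rfl⟩
  obtain ⟨p, hp, f, hu⟩ := hx
  have h0 : (u : P.Loc) + ((-u : AddUnits P.Loc) : P.Loc) = 0 := by simp
  generalize ((-u : AddUnits P.Loc) : P.Loc) = y at h0
  induction y using AddLocalization.induction_on with
  | _ y =>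
    obtain ⟨b, g⟩ := y
    rw [hu, AddLocalization.mk_add, ← AddLocalization.mk_zero, AddLocalization.mk_eq_mk_iff,
      AddLocalization.r_iff_exists] at h0
    obtain ⟨e, he⟩ := h0
    have h1 : (e + (f + g) : Q) ∉ P.ideal := (e + (f + g)).2
    apply h1
    have h2 : (e : Q) + ((0 : P.compl) + (p + b)) ∈ P.ideal := by
      have : (e : Q) + (((0 : P.compl) : Q) + (p + b)) = ((e : Q) + b) + p := by
        simp only [ZeroMemClass.coe_zero, zero_add]
        abel
      rw [this]
      exact AddSemigroupIdeal.add_mem _ _ hp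
    have h3 : (e : Q) + ((0 : P.compl) + (p + b)) = e + (f + g) := by
      simpa using he
    rwa [h3] at h2

theorem MonoidPrime.add_mem_extIdeal (P : MonoidPrime Q) {x : P.Loc} (hx : x ∈ P.extIdeal)
    (y : P.Loc) : x + y ∈ P.extIdeal := by
  obtain ⟨p, hp, f, rfl⟩ := hx
  induction y using AddLocalization.induction_on with
  | _ y =>
    obtain ⟨b, g⟩ := y
    refine ⟨p + b, ?_, f + g, AddLocalization.mk_add _ _ _ _⟩
    rw [add_comm]
    exact AddSemigroupIdeal.add_mem _ _ hp

/-- The stabilizer `K_q^P` of the image of `q` in `Q̄_P` under the action of the unit group `G_P`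
of `Q_P`. -/
def stab (c : AddCon Q) (P : MonoidPrime Q) (q : Q) : AddSubgroup (AddUnits P.Loc) where
  carrier := {g | (locCon c P).mk' (g : P.Loc) + bar c P q = bar c P q}
  zero_mem' := by simp
  add_mem' := fun {g h} hg hh => by
    simp only [Set.mem_ofPred_eq, AddUnits.val_add, map_add] at *
    rw [add_assoc, hh, hg]
  neg_mem' := fun {g} hg => by
    simp only [Set.mem_ofPred_eq] at *
    conv_lhs => rw [← hg]
    rw [← add_assoc, ← map_add]
    simp

/-- The congruence on `Q_P` whose classes are `P_P` and the cosets of `K_q^P` in `G_P`. -/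
def primeConLoc (c : AddCon Q) (P : MonoidPrime Q) (q : Q) : AddCon P.Loc where
  r x y := (x ∈ P.extIdeal ∧ y ∈ P.extIdeal) ∨
    ∃ g h : AddUnits P.Loc, (g : P.Loc) = x ∧ (h : P.Loc) = y ∧ g - h ∈ stab c P q
  iseqv := by
    refine ⟨fun x => ?_, ?_, ?_⟩
    · rcases P.isAddUnit_or_mem_extIdeal x with ⟨u, hu⟩ | h
      · exact Or.inr ⟨u, u, hu, hu, by simp⟩
      · exact Or.inl ⟨h, h⟩
    · rintro x y (⟨hx, hy⟩ | ⟨g, h, hg, hh, hs⟩)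
      · exact Or.inl ⟨hy, hx⟩
      · exact Or.inr ⟨h, g, hh, hg, by simpa using neg_mem hs⟩
    · rintro x y z (⟨hx, hy⟩ | ⟨g, h, rfl, rfl, hs⟩) (⟨hy', hz⟩ | ⟨g', h', hg', rfl, hs'⟩)
      · exact Or.inl ⟨hx, hz⟩
      · exact absurd ⟨g', hg'⟩ (P.not_isAddUnit_of_mem_extIdeal hy)
      · exact absurd ⟨h, rfl⟩ (P.not_isAddUnit_of_mem_extIdeal hy')
      · obtain rfl := AddUnits.ext hg'
        exact Or.inr ⟨g, h', rfl, rfl, by simpa using add_mem hs hs'⟩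
  add' := by
    rintro x y z t (⟨hx, hy⟩ | ⟨g, h, rfl, rfl, hs⟩) h2
    · exact Or.inl ⟨P.add_mem_extIdeal hx _, P.add_mem_extIdeal hy _⟩
    · rcases h2 with ⟨hz, ht⟩ | ⟨g', h', rfl, rfl, hs'⟩
      · rw [add_comm _ z, add_comm _ t]
        exact Or.inl ⟨P.add_mem_extIdeal hz _, P.add_mem_extIdeal ht _⟩
      · refine Or.inr ⟨g + g', h + h', rfl, rfl, ?_⟩
        rw [add_sub_add_comm]
        exact add_mem hs hs'

/-- The `P`-prime congruence of `∼` at `q`: the kernel of `Q → Q_P / ≈`. -/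
def primeCon (c : AddCon Q) (P : MonoidPrime Q) (q : Q) : AddCon Q :=
  AddCon.comap P.toLoc (fun x y => map_add P.toLoc x y) (primeConLoc c P q)

/-- The discrete testimony of `w` at `P`: the set of `P`-cover congruences, that is, of
`P`-prime congruences at the non-nil elements `w + p` for generators `p` of `P`. -/
def testimony (c : AddCon Q) (P : MonoidPrime Q) (S : Set Q) (w : Q) : Set (AddCon Q) :=
  {D | ∃ p ∈ S, ¬ IsNil (bar c P (w + p)) ∧ D = primeCon c P (w + p)}

/-- The discrete testimony of `w` is suspicious: the common refinement of the `P`-cover congruences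
is the `P`-prime congruence at `w`. (The common refinement of no congruence at all is the
universal congruence.) -/
def IsSuspicious (c : AddCon Q) (P : MonoidPrime Q) (S : Set Q) (w : Q) : Prop :=
  sInf (testimony c P S w) = primeCon c P w

/-- `w` is maximal, for divisibility in `Q̄_P`, among the key witnesses for `P`. -/
def IsMaximalKeyWitness (c : AddCon Q) (P : MonoidPrime Q) (S : Set Q) (w : Q) : Prop :=
  IsGreenMaximalIn (bar c P '' {v | IsKeyWitness c P S v}) (bar c P w)

/-- `w` is a true witness for `P`. -/
def IsTrueWitness (c : AddCon Q) (P : MonoidPrime Q) (S : Set Q) (w : Q) : Prop :=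
  IsKeyWitness c P S w ∧ (IsMaximalKeyWitness c P S w ∨ ¬ IsSuspicious c P S w)

/-- The relation `a ∼_w^P b` defining the coprincipal component. -/
def ComponentRel (c : AddCon Q) (P : MonoidPrime Q) (w a b : Q) : Prop :=
  (¬ GreenLE (bar c P a) (bar c P w) ∧ ¬ GreenLE (bar c P b) (bar c P w)) ∨
    ((∃ u : AddUnits (LocQuot c P), bar c P b = bar c P a + u) ∧
      ∃ d : LocQuot c P, bar c P a + d = bar c P w ∧ bar c P b + d = bar c P w)

theorem ComponentRel.symm {c : AddCon Q} {P : MonoidPrime Q} {w a b : Q}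
    (h : ComponentRel c P w a b) : ComponentRel c P w b a := by
  rcases h with ⟨h1, h2⟩ | ⟨⟨u, hu⟩, d, h1, h2⟩
  · exact Or.inl ⟨h2, h1⟩
  · exact Or.inr ⟨⟨-u, by rw [hu, add_assoc]; simp⟩, d, h2, h1⟩

theorem ComponentRel.trans {c : AddCon Q} {P : MonoidPrime Q} {w a b e : Q}
    (h : ComponentRel c P w a b) (h' : ComponentRel c P w b e) : ComponentRel c P w a e := by
  rcases h with ⟨h1, h2⟩ | ⟨⟨u, hu⟩, d, h1, h2⟩ <;>
    rcases h' with ⟨h3, h4⟩ | ⟨⟨v, hv⟩, d', h3, h4⟩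
  · exact Or.inl ⟨h1, h4⟩
  · exact absurd ⟨d', h3.symm⟩ h2
  · exact absurd ⟨d, h2.symm⟩ h3
  · refine Or.inr ⟨⟨u + v, by rw [hv, hu, AddUnits.val_add, add_assoc]⟩, d, h1, ?_⟩
    calc bar c P e + d = (bar c P b + d) + v := by rw [hv]; abel
      _ = (bar c P b + v) + d' := by rw [h2, ← h3]; abel
      _ = bar c P w := by rw [← hv, h4]

theorem ComponentRel.add_right {c : AddCon Q} {P : MonoidPrime Q} {w a b : Q}
    (h : ComponentRel c P w a b) (r : Q) : ComponentRel c P w (a + r) (b + r) := by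
  rcases h with ⟨h1, h2⟩ | ⟨⟨u, hu⟩, d, h1, h2⟩
  · refine Or.inl ⟨?_, ?_⟩
    · rintro ⟨z, hz⟩
      exact h1 ⟨bar c P r + z, by rw [hz, map_add, add_assoc]⟩
    · rintro ⟨z, hz⟩
      exact h2 ⟨bar c P r + z, by rw [hz, map_add, add_assoc]⟩
  · have hwu : bar c P w + u = bar c P w := by
      calc bar c P w + u = (bar c P a + u) + d := by rw [← h1]; abel
        _ = bar c P w := by rw [← hu, h2]
    have key : ∀ z, bar c P (a + r) + z = bar c P w ↔ bar c P (b + r) + z = bar c P w := by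
      intro z
      have e : bar c P (b + r) + z = (bar c P (a + r) + z) + u := by
        rw [map_add, map_add, hu]; abel
      rw [e]
      refine ⟨fun hz => by rw [hz, hwu], fun hz => ?_⟩
      have hz' : (bar c P (a + r) + z) + u = bar c P w + u := by rw [hz, hwu]
      exact u.isAddUnit.add_right_cancel hz'
    by_cases hz : ∃ z, bar c P (a + r) + z = bar c P w
    · obtain ⟨z, hz⟩ := hz
      exact Or.inr ⟨⟨u, by rw [map_add, map_add, hu]; abel⟩, z, hz, (key z).1 hz⟩
    · exact Or.inl ⟨fun ⟨z, h⟩ => hz ⟨z, h.symm⟩, fun ⟨z, h⟩ => hz ⟨z, (key z).2 h.symm⟩⟩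

/-- The coprincipal component `∼_w^P` of `∼` cogenerated by `w`. -/
def component (c : AddCon Q) (P : MonoidPrime Q) (w : Q) : AddCon Q where
  r := ComponentRel c P w
  iseqv := by
    refine ⟨fun a => ?_, ComponentRel.symm, ComponentRel.trans⟩
    by_cases ha : GreenLE (bar c P a) (bar c P w)
    · obtain ⟨z, hz⟩ := ha
      exact Or.inr ⟨⟨0, by simp⟩, z, hz.symm, hz.symm⟩
    · exact Or.inl ⟨ha, ha⟩
  add' := fun {x y z t} h h' => by
    have h1 := h.add_right z
    have h2 := h'.add_right y
    rw [add_comm z y, add_comm t y] at h2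
    exact h1.trans h2

/-- The coprincipal components of `∼` cogenerated by key witnesses (for any prime). -/
def keyComponents (c : AddCon Q) (gen : MonoidPrime Q → Set Q) : Set (AddCon Q) :=
  {D | ∃ (P : MonoidPrime Q) (w : Q), IsKeyWitness c P (gen P) w ∧ D = component c P w}

/-- The coprincipal components of `∼` cogenerated by true witnesses (for any prime). -/
def trueComponents (c : AddCon Q) (gen : MonoidPrime Q → Set Q) : Set (AddCon Q) :=
  {D | ∃ (P : MonoidPrime Q) (w : Q), IsTrueWitness c P (gen P) w ∧ D = component c P w}

end Mesoprimary

/-!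
The argument works in the localized quotient `Q̄_P = Q_P / ∼`, whose elements are either images of
units of `Q_P` or multiples of elements of `P`.

*Key witnesses separate.* If `a ≁ b`, choose `u` such that the ideal of all `x` with
`a + u + x ∼ b + u + x` is maximal among the proper ones. It is a prime `P`
(`exists_mergeIdeal_eq_prime`), the elements `a + u` and `b + u` remain distinct in `Q̄_P` but
agree after adding any element of `P`, so in a suitable order they are a key witness `w` and its
aide `q` (`exists_isKeyAide`). The component of `w` separates `a` from `b`
(`not_component_of_add_ne`).

*Witnesses that are not true.* Two facts restrict such a `w`. An aide of a suspicious `w` does not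
differ from it by a unit (`IsKeyAide.ne_add_addUnit`). If an aide is a multiple `w + x` with `x` in
`P_P`, then `w` is maximal (`IsKeyAide.greenLE_of_isKeyWitness`), because `x` fixes everything
strictly above `w`, which key witnesses do not allow. So if `w` is not true, then `w` does not
divide `q`, and `a`, `b` do not differ by a unit.

*First part.* A component never relates a divisor `a` of its cogenerator to an element that does
not differ from `a` by a unit of `Q̄_P`. Hence every key witness above `w` separates `a` from `b`.
A maximal one exists by an ascending chain condition for key witnesses
(`IsKeyWitness.exists_isMaximalKeyWitness`), which comes from Rédei's theorem
(`wellFoundedGT_addCon`), and maximal key witnesses are true.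

*Second part.* If the component of `a + u` is the excluded one, then the prime and the Green class
of `a + u` are those of the given witness (`eq_and_greenLE_iff_of_component_eq`), so `a + u` is not
true either. Then `b + u` is a key witness with aide `a + u`
(`IsKeyAide.symm_of_not_isTrueWitness`). Its component separates `a` from `b`, and it is a
different component since `a + u` does not divide `b + u`.
-/

namespace Mesoprimary

/-! ### Noetherian property of congruences -/

section Noetherian

variable {Q : Type*} [AddCommMonoid Q]

theorem single_sub_single_mem_span_iff (c : AddCon Q) (a b : Q) :
    (AddMonoidAlgebra.single a 1 - AddMonoidAlgebra.single b 1 : AddMonoidAlgebra ℤ Q) ∈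
      Ideal.span {f : AddMonoidAlgebra ℤ Q | ∃ x y, c x y ∧
        f = AddMonoidAlgebra.single x 1 - AddMonoidAlgebra.single y 1} ↔ c a b := by
  refine ⟨fun h => ?_, fun h => Ideal.subset_span ⟨a, b, h, rfl⟩⟩
  have hle : Ideal.span {f : AddMonoidAlgebra ℤ Q | ∃ x y, c x y ∧
      f = AddMonoidAlgebra.single x 1 - AddMonoidAlgebra.single y 1} ≤
        RingHom.ker (AddMonoidAlgebra.mapDomainRingHom ℤ c.mk') := by
    rw [Ideal.span_le]
    rintro _ ⟨x, y, hxy, rfl⟩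
    have : (x : c.Quotient) = y := (AddCon.eq c).2 hxy
    simp only [SetLike.mem_coe, RingHom.mem_ker, map_sub,
      AddMonoidAlgebra.mapDomainRingHom_apply, AddMonoidAlgebra.mapDomain_single,
      AddCon.coe_mk', this, sub_self]
  have hk := hle h
  rw [RingHom.mem_ker, map_sub, sub_eq_zero] at hk
  simp only [AddMonoidAlgebra.mapDomainRingHom_apply, AddMonoidAlgebra.mapDomain_single] at hk
  exact (AddCon.eq c).1 (AddMonoidAlgebra.single_left_injective one_ne_zero hk)

/-- Rédei's theorem: a finitely generated commutative monoid is Noetherian for congruences. It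
follows from Hilbert's basis theorem for the monoid algebra `ℤ[Q]`, as a congruence `c` is
recovered from the ideal spanned by the differences of `c`-related monomials. -/
theorem wellFoundedGT_addCon [AddMonoid.FG Q] : WellFoundedGT (AddCon Q) := by
  have : IsNoetherianRing (AddMonoidAlgebra ℤ Q) := Algebra.FiniteType.isNoetherianRing ℤ _
  let J : AddCon Q → Ideal (AddMonoidAlgebra ℤ Q) := fun c =>
    Ideal.span {f | ∃ x y, c x y ∧
      f = AddMonoidAlgebra.single x 1 - AddMonoidAlgebra.single y 1}
  have hJ : StrictMono J := by
    refine Monotone.strictMono_of_injective (fun c d hcd => Ideal.span_mono ?_) fun c d hcd => ?_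
    · rintro _ ⟨x, y, hxy, rfl⟩
      exact ⟨x, y, hcd hxy, rfl⟩
    · refine AddCon.ext fun a b => ?_
      rw [← single_sub_single_mem_span_iff c, ← single_sub_single_mem_span_iff d]
      exact iff_of_eq (congrArg (_ ∈ ·) hcd)
  exact hJ.wellFoundedGT

/-- The Rees congruence of a monoid ideal `I`: the ideal is collapsed to a point. -/
def reesCon (I : AddSemigroupIdeal Q) : AddCon Q where
  r x y := x = y ∨ (x ∈ I ∧ y ∈ I)
  iseqv := by
    refine ⟨fun x => Or.inl rfl, ?_, ?_⟩
    · rintro x y (rfl | ⟨hx, hy⟩)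
      exacts [Or.inl rfl, Or.inr ⟨hy, hx⟩]
    · rintro x y z (rfl | ⟨hx, hy⟩) (rfl | ⟨hy', hz⟩)
      exacts [Or.inl rfl, Or.inr ⟨hy', hz⟩, Or.inr ⟨hx, hy⟩, Or.inr ⟨hx, hz⟩]
  add' := by
    rintro x y z t (rfl | ⟨hx, hy⟩) (rfl | ⟨hz, ht⟩)
    · exact Or.inl rfl
    · exact Or.inr ⟨AddSemigroupIdeal.add_mem I _ hz, AddSemigroupIdeal.add_mem I _ ht⟩
    · rw [add_comm x, add_comm y]
      exact Or.inr ⟨AddSemigroupIdeal.add_mem I _ hx, AddSemigroupIdeal.add_mem I _ hy⟩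
    · exact Or.inr ⟨AddSemigroupIdeal.add_mem I _ hz, AddSemigroupIdeal.add_mem I _ ht⟩

/-- The ideal of all `x` whose addition merges the classes of `a` and `b`. -/
def mergeIdeal (c : AddCon Q) (a b : Q) : AddSemigroupIdeal Q where
  carrier := {x | c (a + x) (b + x)}
  vadd_mem' r x hx := by
    have h := c.add (c.refl r) hx
    simp only [vadd_eq_add, Set.mem_ofPred_eq] at *
    rwa [add_left_comm, add_left_comm r b] at h

theorem mem_mergeIdeal {c : AddCon Q} {a b x : Q} :
    x ∈ mergeIdeal c a b ↔ c (a + x) (b + x) := Iff.rfl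

/-- Associated primes exist: two inequivalent elements have inequivalent translates that are merged
exactly by the elements of a prime ideal. It is a maximal one among the proper merging ideals of
translates. -/
theorem exists_mergeIdeal_eq_prime [AddMonoid.FG Q] (c : AddCon Q) {a b : Q} (hab : ¬ c a b) :
    ∃ (P : MonoidPrime Q) (u : Q), ∀ x, x ∈ P.ideal ↔ c (a + u + x) (b + u + x) := by
  have := wellFoundedGT_addCon (Q := Q)
  let T : Set (AddCon Q) :=
    {D | ∃ u, ¬ c (a + u) (b + u) ∧ D = reesCon (mergeIdeal c (a + u) (b + u))}
  have hT : T.Nonempty := ⟨_, 0, by simpa using hab, rfl⟩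
  obtain ⟨_, ⟨u, hu, rfl⟩, hmax⟩ := (wellFounded_gt (α := AddCon Q)).has_min T hT
  refine ⟨⟨mergeIdeal c (a + u) (b + u), by simpa [mem_mergeIdeal] using hu, ?_⟩, u,
    fun x => Iff.rfl⟩
  intro x y hxy
  by_contra! hn
  obtain ⟨hx, hy⟩ := hn
  have hle : mergeIdeal c (a + u) (b + u) ≤ mergeIdeal c (a + (u + x)) (b + (u + x)) := by
    intro z hz
    have h := c.add (mem_mergeIdeal.1 hz) (c.refl x)
    rw [mem_mergeIdeal]
    convert h using 1 <;> abel
  have hy' : y ∈ mergeIdeal c (a + (u + x)) (b + (u + x)) := by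
    rw [mem_mergeIdeal] at hxy ⊢
    convert hxy using 1 <;> abel
  refine hmax (reesCon (mergeIdeal c (a + (u + x)) (b + (u + x))))
    ⟨u + x, by simpa [mem_mergeIdeal, add_assoc] using hx, rfl⟩ ?_
  refine lt_of_le_of_ne ?_ fun heq => ?_
  · rintro s t (rfl | ⟨hs, ht⟩)
    exacts [Or.inl rfl, Or.inr ⟨hle hs, hle ht⟩]
  · -- In the larger congruence `y` is related to `x + y`; equality would put `y` in the ideal.
    have h : reesCon (mergeIdeal c (a + u) (b + u)) y (x + y) := by
      rw [heq]
      exact Or.inr ⟨hy', hle hxy⟩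
    rcases h with h | ⟨h, -⟩
    · exact hy (h ▸ hxy)
    · exact hy h

end Noetherian

/-! ### Localization at a prime -/

section Localization

variable {Q : Type*} [AddCommMonoid Q] {c : AddCon Q} {P : MonoidPrime Q} {S : Set Q}

theorem GreenLE.trans {M : Type*} [AddCommMonoid M] {x y z : M} (h : GreenLE x y)
    (h' : GreenLE y z) : GreenLE x z := by
  obtain ⟨s, rfl⟩ := h
  obtain ⟨t, rfl⟩ := h'
  exact ⟨s + t, add_assoc _ _ _⟩

theorem GreenLE.refl {M : Type*} [AddCommMonoid M] (x : M) : GreenLE x x := ⟨0, by simp⟩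

theorem greenLE_of_eq_add_addUnit {M : Type*} [AddCommMonoid M] {x y : M} {u : AddUnits M}
    (h : y = x + u) : GreenLE y x :=
  ⟨(-u : AddUnits M), by simp [h, add_assoc]⟩

theorem IsNil.of_greenLE {M : Type*} [AddCommMonoid M] {x y : M} (hx : IsNil x)
    (h : GreenLE x y) : IsNil y := by
  obtain ⟨z, rfl⟩ := h
  rwa [hx z]

theorem bar_eq_of_rel {a b : Q} (h : c a b) : bar c P a = bar c P b :=
  (AddCon.eq _).2 (AddConGen.Rel.of _ _ ⟨a, b, h, rfl, rfl⟩)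

/-- Equality in `Q̄_P` is witnessed by a denominator. The congruence generated on `Q_P` is contained
in the kernel of the map from `Q_P` to the localization of `Q / ∼`. -/
theorem exists_rel_of_bar_eq {a b : Q} (h : bar c P a = bar c P b) :
    ∃ f ∉ P.ideal, c (a + f) (b + f) := by
  let T : AddSubmonoid c.Quotient := P.compl.map c.mk'
  let φ : P.Loc →+ AddLocalization T :=
    (AddLocalization.addMonoidOf P.compl).map (g := c.mk') (T := T)
      (fun y => ⟨y, y.2, rfl⟩) (AddLocalization.addMonoidOf T)
  have hφ : ∀ x, φ (P.toLoc x) = AddLocalization.addMonoidOf T (c.mk' x) := fun x =>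
    AddSubmonoid.LocalizationMap.map_eq _ _ _
  have hle : locCon c P ≤ AddCon.ker φ := by
    refine AddCon.addConGen_le.2 ?_
    rintro _ _ ⟨x, y, hxy, rfl, rfl⟩
    rw [AddCon.ker_rel, hφ, hφ]
    exact congrArg _ ((AddCon.eq c).2 hxy)
  have h1 : φ (P.toLoc a) = φ (P.toLoc b) := hle ((AddCon.eq _).1 h)
  rw [hφ, hφ, AddSubmonoid.LocalizationMap.eq_iff_exists] at h1
  obtain ⟨⟨_, f, hf, rfl⟩, h2⟩ := h1
  refine ⟨f, hf, (AddCon.eq c).1 ?_⟩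
  simpa [add_comm] using h2

theorem isAddUnit_toLoc {f : Q} (hf : f ∉ P.ideal) : IsAddUnit (P.toLoc f) :=
  (AddLocalization.addMonoidOf P.compl).map_addUnits ⟨f, hf⟩

theorem isAddUnit_bar {f : Q} (hf : f ∉ P.ideal) : IsAddUnit (bar c P f) :=
  (isAddUnit_toLoc hf).map (locCon c P).mk'

theorem greenLE_bar_add {a w f : Q} (hf : f ∉ P.ideal)
    (h : GreenLE (bar c P a) (bar c P w)) : GreenLE (bar c P (a + f)) (bar c P w) := by
  obtain ⟨u, hu⟩ := isAddUnit_bar (c := c) hf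
  exact (greenLE_of_eq_add_addUnit (u := u) (by rw [map_add, hu])).trans h

/-- An element of `Q̄_P` is the image of a unit of `Q_P` or a multiple of an element of `P`. -/
theorem exists_addUnit_or_mem (v : LocQuot c P) :
    (∃ g : AddUnits P.Loc, (locCon c P).mk' (g : P.Loc) = v) ∨
      ∃ p ∈ P.ideal, ∃ y, v = bar c P p + y := by
  obtain ⟨x, rfl⟩ := (locCon c P).mk'_surjective v
  rcases P.isAddUnit_or_mem_extIdeal x with ⟨g, rfl⟩ | ⟨p, hp, f, rfl⟩
  · exact Or.inl ⟨g, rfl⟩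
  · refine Or.inr ⟨p, hp, (locCon c P).mk' (AddLocalization.mk 0 f), ?_⟩
    have : (AddLocalization.mk p f : P.Loc) = P.toLoc p + AddLocalization.mk 0 f := by
      have h0 : P.toLoc p = AddLocalization.mk p 0 :=
        (AddLocalization.mk_zero_eq_addMonoidOf_mk p).symm
      rw [h0, AddLocalization.mk_add, add_zero, zero_add]
    rw [this, map_add]
    rfl

/-- A unit of `Q_P` is a difference of elements outside `P`. -/
theorem exists_toLoc_eq_addUnit_add (g : AddUnits P.Loc) :
    ∃ f ∉ P.ideal, ∃ f' ∉ P.ideal, P.toLoc f = g + P.toLoc f' := by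
  obtain ⟨⟨f, f'⟩, h⟩ := (AddLocalization.addMonoidOf P.compl).surj (g : P.Loc)
  refine ⟨f, fun hf => ?_, f', f'.2, h.symm⟩
  obtain ⟨v, hv⟩ := isAddUnit_toLoc f'.2
  refine P.not_isAddUnit_of_mem_extIdeal ⟨f, hf, 0, ?_⟩ (g + v).isAddUnit
  rw [AddUnits.val_add, hv, AddLocalization.mk_zero_eq_addMonoidOf_mk]
  exact h

theorem MonoidPrime.IsGeneratedBy.exists_eq_add (hS : P.IsGeneratedBy S) {p : Q}
    (hp : p ∈ P.ideal) : ∃ s ∈ S, ∃ r, p = s + r := by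
  rw [← hS, AddSemigroupIdeal.mem_closure''] at hp
  obtain ⟨r, s, hs, rfl⟩ := hp
  exact ⟨s, hs, r, add_comm _ _⟩

theorem MonoidPrime.IsGeneratedBy.subset (hS : P.IsGeneratedBy S) {s : Q} (hs : s ∈ S) :
    s ∈ P.ideal := by
  rw [← hS]
  exact AddSemigroupIdeal.mem_closure_of_mem hs

end Localization

/-! ### Key witnesses and their aides -/

section KeyWitness

variable {Q : Type*} [AddCommMonoid Q] {c : AddCon Q} {P : MonoidPrime Q} {S : Set Q}

theorem IsKeyAide.add_eq {w q p : Q} (hS : P.IsGeneratedBy S) (h : IsKeyAide c P S w q)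
    (hp : p ∈ P.ideal) : bar c P w + bar c P p = bar c P q + bar c P p := by
  obtain ⟨s, hs, r, rfl⟩ := hS.exists_eq_add hp
  rw [map_add, ← add_assoc, ← add_assoc, (h s hs).2.1]

theorem IsKeyAide.ne {w q p : Q} (hS : P.IsGeneratedBy S) (h : IsKeyAide c P S w q)
    (hp : p ∈ P.ideal) : bar c P w ≠ bar c P q := by
  obtain ⟨s, hs, r, rfl⟩ := hS.exists_eq_add hp
  exact (h s hs).1

theorem IsKeyAide.greenLE_of_greenLE {w q p : Q} (hS : P.IsGeneratedBy S)
    (h : IsKeyAide c P S w q) (hp : p ∈ P.ideal) (hle : GreenLE (bar c P q) (bar c P w)) :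
    GreenLE (bar c P w) (bar c P q) := by
  obtain ⟨s, hs, r, rfl⟩ := hS.exists_eq_add hp
  exact (h s hs).2.2.2 _ (by simp) hle

/-- Adding an element of `P` to a key witness leaves its Green class for good: were `p + z` to fix
`w`, then `q` would divide `w`, hence be a multiple of it, and `p + z` would fix `q` as well. -/
theorem IsKeyAide.add_ne {w q p : Q} (hS : P.IsGeneratedBy S) (h : IsKeyAide c P S w q)
    (hp : p ∈ P.ideal) (z : LocQuot c P) : bar c P w + bar c P p + z ≠ bar c P w := by
  intro hz
  have hq : bar c P q + bar c P p + z = bar c P w := by rw [← h.add_eq hS hp, hz]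
  obtain ⟨y, hy⟩ := h.greenLE_of_greenLE hS hp ⟨bar c P p + z, by rw [← add_assoc, hq]⟩
  refine h.ne hS hp ?_
  calc bar c P w = bar c P q + bar c P p + z := hq.symm
    _ = bar c P w + bar c P p + z + y := by rw [hy]; abel
    _ = bar c P q := by rw [hz, hy]

theorem IsKeyAide.not_greenLE_add {w q p : Q} (hS : P.IsGeneratedBy S) (h : IsKeyAide c P S w q)
    (hp : p ∈ P.ideal) : ¬ GreenLE (bar c P (w + p)) (bar c P w) := by
  rintro ⟨z, hz⟩
  exact h.add_ne hS hp z (by rw [← map_add, ← hz])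

/-- If there is a key witness at all, no element of `P` becomes a unit in `Q̄_P`, so that all units
of `Q̄_P` come from `Q_P`. -/
theorem IsKeyAide.exists_lift_addUnit {w q : Q} (hS : P.IsGeneratedBy S)
    (h : IsKeyAide c P S w q) (u : AddUnits (LocQuot c P)) :
    ∃ g : AddUnits P.Loc, (locCon c P).mk' (g : P.Loc) = u := by
  rcases exists_addUnit_or_mem (u : LocQuot c P) with hg | ⟨p, hp, y, hu⟩
  · exact hg
  · refine absurd ?_ (h.add_ne hS hp (y + ((-u : AddUnits _) : LocQuot c P)))
    rw [add_assoc, ← add_assoc (bar c P p), ← hu]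
    simp

/-- A key witness with an aide that is a multiple of it by some `x` in `P_P` is maximal among the
key witnesses: `x` fixes every further multiple of `w`, so it would fix a key witness lying strictly
above `w`. -/
theorem IsKeyAide.greenLE_of_isKeyWitness {w q w' p : Q} {y : LocQuot c P}
    (hS : P.IsGeneratedBy S) (h : IsKeyAide c P S w q) (hp : p ∈ P.ideal)
    (hq : bar c P q = bar c P w + (bar c P p + y)) (hw' : IsKeyWitness c P S w')
    (hle : GreenLE (bar c P w) (bar c P w')) : GreenLE (bar c P w') (bar c P w) := by
  obtain ⟨q', h'⟩ := hw'
  obtain ⟨z, hz⟩ := hle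
  rcases exists_addUnit_or_mem z with ⟨g, rfl⟩ | ⟨p', hp', y', rfl⟩
  · exact greenLE_of_eq_add_addUnit (u := AddUnits.map (locCon c P).mk' g) hz
  · refine absurd ?_ (h'.add_ne hS hp y)
    rw [hz]
    calc bar c P w + (bar c P p' + y') + bar c P p + y
        = bar c P w + (bar c P p + y) + bar c P p' + y' := by abel
      _ = bar c P w + (bar c P p' + y') := by
        rw [← hq, ← h.add_eq hS hp', add_assoc]

/-- An aide of a suspicious key witness `w` does not differ from `w` by a unit: such a unit fixes
all `w + p`, hence `w`. -/
theorem IsKeyAide.ne_add_addUnit {w q : Q} (hS : P.IsGeneratedBy S) (h : IsKeyAide c P S w q)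
    (hne : bar c P w ≠ bar c P q) (hs : IsSuspicious c P S w) (u : AddUnits (LocQuot c P)) :
    bar c P q ≠ bar c P w + u := by
  intro hu
  obtain ⟨g, hg⟩ := h.exists_lift_addUnit hS u
  obtain ⟨f, hf, f', hf', hff⟩ := exists_toLoc_eq_addUnit_add g
  obtain ⟨v, hv⟩ := isAddUnit_toLoc hf
  obtain ⟨v', hv'⟩ := isAddUnit_toLoc hf'
  have hgv : v - v' = g := by
    rw [sub_eq_iff_eq_add]
    exact AddUnits.ext (by rw [hv, hff, AddUnits.val_add, hv'])
  have hall : sInf (testimony c P S w) f f' := by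
    change ∀ D ∈ testimony c P S w, D f f'
    rintro _ ⟨p, hp, -, rfl⟩
    refine Or.inr ⟨v, v', hv, hv', ?_⟩
    rw [hgv]
    change (locCon c P).mk' (g : P.Loc) + bar c P (w + p) = bar c P (w + p)
    rw [hg, map_add, ← add_assoc, add_comm _ (bar c P w), ← hu, h.add_eq hS (hS.subset hp)]
  rw [hs] at hall
  rcases hall with ⟨hx, -⟩ | ⟨k, k', hk, hk', hst⟩
  · exact P.not_isAddUnit_of_mem_extIdeal hx (isAddUnit_toLoc hf)
  · obtain rfl : k = v := AddUnits.ext (hk.trans hv.symm)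
    obtain rfl : k' = v' := AddUnits.ext (hk'.trans hv'.symm)
    rw [hgv] at hst
    have hst' : (locCon c P).mk' (g : P.Loc) + bar c P w = bar c P w := hst
    refine hne ?_
    rw [hu, add_comm, ← hg, hst']

end KeyWitness

/-! ### Existence of maximal key witnesses -/

section Maximal

variable {Q : Type*} [AddCommMonoid Q] {c : AddCon Q} {P : MonoidPrime Q} {S : Set Q}

/-- The syntactic congruence of an element `m` of `Q̄_P`: two elements are related if they have the
same translates with image `m`. -/
def syntacticCon (c : AddCon Q) (P : MonoidPrime Q) (m : LocQuot c P) : AddCon Q where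
  r a b := ∀ t, bar c P (a + t) = m ↔ bar c P (b + t) = m
  iseqv := ⟨fun _ _ => Iff.rfl, fun h t => (h t).symm, fun h h' t => (h t).trans (h' t)⟩
  add' := by
    intro a b a' b' h h' t
    rw [add_assoc, h, add_left_comm, h', add_left_comm, add_assoc]

/-- Every key witness with another key witness strictly above it lies strictly below a maximal one.
If `v ↦ q_v` chooses key aides, then the congruence generated by the pairs `(v, q_v)` with `v`
dividing `y` grows strictly with `y`, as the syntactic congruence of `y' > y` contains it but not
the pair `(y', q_{y'})`. Congruences satisfy the ascending chain condition. -/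
theorem IsKeyWitness.exists_isMaximalKeyWitness [AddMonoid.FG Q] (hS : P.IsGeneratedBy S)
    {w : Q} (hw : IsKeyWitness c P S w) (hmax : ¬ IsMaximalKeyWitness c P S w) :
    ∃ y, IsKeyWitness c P S y ∧ IsMaximalKeyWitness c P S y ∧
      GreenLE (bar c P w) (bar c P y) ∧ ¬ GreenLE (bar c P y) (bar c P w) := by
  classical
  have := wellFoundedGT_addCon (Q := Q)
  choose! aide haide using fun (v : Q) (hv : IsKeyWitness c P S v) => hv
  let J : Q → AddCon Q := fun y => addConGen fun a b =>
    IsKeyWitness c P S a ∧ GreenLE (bar c P a) (bar c P y) ∧ b = aide a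
  have hJ : ∀ y y', IsKeyWitness c P S y' → GreenLE (bar c P y) (bar c P y') →
      ¬ GreenLE (bar c P y') (bar c P y) → J y < J y' := by
    intro y y' hy' hle hnle
    refine lt_of_le_of_ne (AddCon.addConGen_mono ?_) fun heq => ?_
    · rintro a b ⟨ha, hay, rfl⟩
      exact ⟨ha, hay.trans hle, rfl⟩
    -- A strict inequality is only possible if `P` is nonempty.
    have hP : ∃ p, p ∈ P.ideal := by
      obtain ⟨z, hz⟩ := hle
      rcases exists_addUnit_or_mem z with ⟨g, rfl⟩ | ⟨p, hp, -⟩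
      · exact absurd (greenLE_of_eq_add_addUnit (u := AddUnits.map (locCon c P).mk' g) hz) hnle
      · exact ⟨p, hp⟩
    obtain ⟨p, hp⟩ := hP
    have hsyn : J y ≤ syntacticCon c P (bar c P y') := by
      refine AddCon.addConGen_le.2 ?_
      rintro v _ ⟨hv, hvy, rfl⟩ t
      by_cases ht : t ∈ P.ideal
      · rw [map_add, (haide v hv).add_eq hS ht, ← map_add]
      obtain ⟨u, hu⟩ := isAddUnit_bar (c := c) ht
      refine iff_of_false (fun h => ?_) fun h => ?_
      · rw [map_add, ← hu] at h
        exact hnle ((greenLE_of_eq_add_addUnit h.symm).trans hvy)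
      · have hy'q : GreenLE (bar c P y') (bar c P (aide v)) :=
          greenLE_of_eq_add_addUnit (u := u) (by rw [← h, map_add, hu])
        obtain ⟨x, hx⟩ := (hvy.trans hle).trans hy'q
        rcases exists_addUnit_or_mem x with ⟨g, rfl⟩ | ⟨p', hp', z, rfl⟩
        · exact hnle ((hy'q.trans (greenLE_of_eq_add_addUnit
            (u := AddUnits.map (locCon c P).mk' g) hx)).trans hvy)
        · exact hnle (((haide v hv).greenLE_of_isKeyWitness hS hp' hx hy' (hvy.trans hle)).trans
            hvy)
    have hpair : J y' y' (aide y') :=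
      AddConGen.Rel.of _ _ ⟨hy', GreenLE.refl _, rfl⟩
    rw [← heq] at hpair
    have h0 := (hsyn hpair 0).1 (by rw [add_zero])
    rw [add_zero] at h0
    exact (haide y' hy').ne hS hp h0.symm
  let T : Set Q := {y | IsKeyWitness c P S y ∧ GreenLE (bar c P w) (bar c P y) ∧
    ¬ GreenLE (bar c P y) (bar c P w)}
  have hT : (J '' T).Nonempty := by
    refine Set.Nonempty.image _ ?_
    by_contra hne
    refine hmax ⟨⟨w, hw, rfl⟩, ?_⟩
    rintro _ ⟨y, hy, rfl⟩ hwy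
    by_contra hyw
    exact hne ⟨y, hy, hwy, hyw⟩
  obtain ⟨_, ⟨y, ⟨hy, hwy, hyw⟩, rfl⟩, hmin⟩ :=
    (wellFounded_gt (α := AddCon Q)).has_min _ hT
  refine ⟨y, hy, ⟨⟨y, hy, rfl⟩, ?_⟩, hwy, hyw⟩
  rintro _ ⟨y', hy', rfl⟩ hyy'
  by_contra hy'y
  exact hmin (J y') ⟨y', ⟨hy', hwy.trans hyy', fun h => hy'y (h.trans hwy)⟩, rfl⟩
    (hJ y y' hy' hyy' hy'y)

end Maximal

/-! ### Invariance of true witnesses under units -/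

section Invariance

variable {Q : Type*} [AddCommMonoid Q] {c : AddCon Q} {P : MonoidPrime Q} {S : Set Q}

theorem stab_mono {w w' : Q} (h : GreenLE (bar c P w) (bar c P w')) :
    stab c P w ≤ stab c P w' := by
  obtain ⟨z, hz⟩ := h
  intro g hg
  have hg' : (locCon c P).mk' (g : P.Loc) + bar c P w = bar c P w := hg
  change (locCon c P).mk' (g : P.Loc) + bar c P w' = bar c P w'
  rw [hz, ← add_assoc, hg']

theorem primeCon_congr {w w' : Q} (h : GreenLE (bar c P w) (bar c P w'))
    (h' : GreenLE (bar c P w') (bar c P w)) : primeCon c P w = primeCon c P w' := by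
  have hst : stab c P w = stab c P w' := le_antisymm (stab_mono h) (stab_mono h')
  have : primeConLoc c P w = primeConLoc c P w' := by
    refine AddCon.ext fun x y => ?_
    change (_ ∨ ∃ g h : AddUnits P.Loc, _ ∧ _ ∧ g - h ∈ stab c P w) ↔
      (_ ∨ ∃ g h : AddUnits P.Loc, _ ∧ _ ∧ g - h ∈ stab c P w')
    rw [hst]
  rw [primeCon, this, primeCon]

theorem greenLE_bar_add_add {w w' : Q} (h : GreenLE (bar c P w) (bar c P w')) (p : Q) :
    GreenLE (bar c P (w + p)) (bar c P (w' + p)) := by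
  obtain ⟨z, hz⟩ := h
  exact ⟨z, by rw [map_add, map_add, hz]; abel⟩

theorem testimony_subset {w w' : Q} (h : GreenLE (bar c P w) (bar c P w'))
    (h' : GreenLE (bar c P w') (bar c P w)) : testimony c P S w ⊆ testimony c P S w' := by
  rintro _ ⟨p, hp, hnil, rfl⟩
  have h1 := greenLE_bar_add_add h p
  have h2 := greenLE_bar_add_add h' p
  exact ⟨p, hp, fun hn => hnil (hn.of_greenLE h2), primeCon_congr h1 h2⟩

theorem IsSuspicious.of_greenLE {w w' : Q} (hs : IsSuspicious c P S w)
    (h : GreenLE (bar c P w) (bar c P w')) (h' : GreenLE (bar c P w') (bar c P w)) :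
    IsSuspicious c P S w' := by
  rw [IsSuspicious, ← primeCon_congr h h', ← hs,
    (testimony_subset h h').antisymm (testimony_subset h' h)]

theorem IsMaximalKeyWitness.of_greenLE {w w' : Q} (hm : IsMaximalKeyWitness c P S w)
    (hw' : IsKeyWitness c P S w')
    (h : GreenLE (bar c P w) (bar c P w')) :
    IsMaximalKeyWitness c P S w' :=
  ⟨⟨w', hw', rfl⟩, fun y hy hle => (hm.2 y hy (h.trans hle)).trans h⟩

end Invariance

/-! ### Coprincipal components -/

section Component

variable {Q : Type*} [AddCommMonoid Q] {c : AddCon Q}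

theorem le_component (P : MonoidPrime Q) (w : Q) : c ≤ component c P w := by
  intro a b hab
  have h := (component c P w).refl a
  change ComponentRel c P w a a at h
  change ComponentRel c P w a b
  rwa [ComponentRel, bar_eq_of_rel hab] at h ⊢

/-- A component separates `a` from `b` as soon as a translate by the same element carries `a`, but
not `b`, to the cogenerator. -/
theorem not_component_of_add_ne {P : MonoidPrime Q} {a b u : Q}
    (h : bar c P (a + u) ≠ bar c P (b + u)) : ¬ component c P (a + u) a b := by
  rintro (⟨ha, -⟩ | ⟨⟨v, hv⟩, d, had, hbd⟩)
  · exact ha ⟨bar c P u, map_add _ _ _⟩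
  · -- Both `a + u` and `a + d` are `w`, and the unit `v` fixes `w`.
    refine h ?_
    calc bar c P (a + u) = bar c P b + d := hbd.symm
      _ = (bar c P a + d) + v := by rw [hv]; abel
      _ = (bar c P a + bar c P u) + v := by rw [had, map_add]
      _ = bar c P (b + u) := by rw [map_add, hv]; abel

/-- The component of `w` determines the elements that do not divide `w`: their class is the nil of
the quotient. A divisor `x` of `w'` could have nil class in the quotient by the component of `w'`
only if that quotient were trivial, but `w` and `x` are not related. -/
theorem not_greenLE_of_component_eq {P P' : MonoidPrime Q} {S' : Set Q} {w w' x : Q}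
    (hS' : P'.IsGeneratedBy S') (hw' : IsKeyWitness c P' S' w')
    (h : component c P w = component c P' w') (hx : ¬ GreenLE (bar c P x) (bar c P w)) :
    ¬ GreenLE (bar c P' x) (bar c P' w') := by
  obtain ⟨q', hq'⟩ := hw'
  intro hx'
  have hnil : ∀ y, component c P' w' x (x + y) := fun y => by
    rw [← h]
    refine Or.inl ⟨hx, ?_⟩
    rw [map_add]
    exact fun ⟨z, hz⟩ => hx ⟨bar c P y + z, by rw [hz, add_assoc]⟩
  have hle : ∀ y, ∃ d, bar c P' x + d = bar c P' w' ∧ bar c P' (x + y) + d = bar c P' w' :=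
    fun y => (hnil y).elim (fun hn => absurd hx' hn.1) fun hd => hd.2
  have hP' : ∀ p, p ∉ P'.ideal := by
    intro p hp
    obtain ⟨d, -, hd⟩ := hle (w' + p)
    rw [map_add, map_add] at hd
    refine hq'.add_ne hS' hp (bar c P' x + d) (Eq.trans ?_ hd)
    abel
  -- With `P'` empty, `Q̄_{P'}` is a group, which the previous equations show to be trivial.
  have hzero : ∀ y, bar c P' y = 0 := by
    intro y
    obtain ⟨d, h1, h2⟩ := hle y
    obtain ⟨u, hu⟩ := isAddUnit_bar (c := c) (hP' w')
    have h3 : (u : LocQuot c P') + bar c P' y = u + 0 := by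
      rw [add_zero, hu]
      nth_rewrite 1 [← h1]
      rw [← h2, map_add]
      abel
    exact u.isAddUnit.add_left_cancel h3
  have hrel : component c P w w x := by
    rw [h]
    have h0 := (component c P' w').refl w
    change ComponentRel c P' w' w w at h0
    change ComponentRel c P' w' w x
    rw [ComponentRel] at h0 ⊢
    rwa [hzero x, ← hzero w]
  rcases hrel with ⟨hn, -⟩ | ⟨-, d, -, hd⟩
  · exact hn (GreenLE.refl _)
  · exact hx ⟨d, hd.symm⟩

/-- The component cogenerated by a key witness determines its prime and the Green class of the
witness. -/
theorem eq_and_greenLE_iff_of_component_eq {P P' : MonoidPrime Q} {S S' : Set Q} {w w' : Q}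
    (hS : P.IsGeneratedBy S) (hS' : P'.IsGeneratedBy S') (hw : IsKeyWitness c P S w)
    (hw' : IsKeyWitness c P' S' w') (h : component c P w = component c P' w') :
    P = P' ∧ ∀ x, GreenLE (bar c P x) (bar c P w) ↔ GreenLE (bar c P' x) (bar c P' w') := by
  have key : ∀ x, GreenLE (bar c P x) (bar c P w) ↔ GreenLE (bar c P' x) (bar c P' w') :=
    fun x => not_iff_not.1 ⟨not_greenLE_of_component_eq hS' hw' h,
      not_greenLE_of_component_eq hS hw h.symm⟩
  refine ⟨?_, key⟩
  have hideal : P.ideal = P'.ideal := by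
    ext p
    constructor <;> intro hp <;> by_contra hp'
    · obtain ⟨q, hq⟩ := hw
      exact hq.not_greenLE_add hS hp
        ((key _).2 (greenLE_bar_add hp' ((key w).1 (GreenLE.refl _))))
    · obtain ⟨q', hq'⟩ := hw'
      exact hq'.not_greenLE_add hS' hp
        ((key _).1 (greenLE_bar_add hp' ((key w').2 (GreenLE.refl _))))
  cases P
  cases P'
  simp only at hideal
  subst hideal
  rfl

end Component

/-! ### Decomposition into components of true witnesses -/

section Decomposition

variable {Q : Type*} [AddCommMonoid Q] {c : AddCon Q}

/-- Inequivalent elements are separated by a key witness: suitable translates `a + u` and `b + u`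
are, in one of the two orders, a key witness and its aide. -/
theorem exists_isKeyAide [AddMonoid.FG Q] (gen : MonoidPrime Q → Set Q)
    (hgen : ∀ P : MonoidPrime Q, P.IsGeneratedBy (gen P)) {a b : Q} (hab : ¬ c a b) :
    ∃ (P : MonoidPrime Q) (u : Q), bar c P (a + u) ≠ bar c P (b + u) ∧
      (IsKeyAide c P (gen P) (a + u) (b + u) ∨ IsKeyAide c P (gen P) (b + u) (a + u)) := by
  obtain ⟨P, u, hP⟩ := exists_mergeIdeal_eq_prime c hab
  have hne : bar c P (a + u) ≠ bar c P (b + u) := fun h => by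
    obtain ⟨f, hf, hc⟩ := exists_rel_of_bar_eq h
    exact hf ((hP f).2 hc)
  have heq : ∀ p ∈ gen P, bar c P (a + u) + bar c P p = bar c P (b + u) + bar c P p :=
    fun p hp => by
      rw [← map_add, ← map_add]
      exact bar_eq_of_rel ((hP p).1 ((hgen P).subset hp))
  refine ⟨P, u, hne, ?_⟩
  by_cases h : GreenLE (bar c P (b + u)) (bar c P (a + u)) →
      GreenLE (bar c P (a + u)) (bar c P (b + u))
  · refine Or.inl fun p hp => ⟨hne, heq p hp, by simp, ?_⟩
    rintro _ (rfl | rfl)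
    exacts [id, h]
  · refine Or.inr fun p hp => ⟨hne.symm, (heq p hp).symm, by simp, ?_⟩
    rintro _ (rfl | rfl)
    exacts [id, fun _ => by_contra fun h' => h fun h'' => absurd h'' h']

theorem not_isTrueWitness_iff {P : MonoidPrime Q} {S : Set Q} {w : Q}
    (hw : IsKeyWitness c P S w) :
    ¬ IsTrueWitness c P S w ↔ ¬ IsMaximalKeyWitness c P S w ∧ IsSuspicious c P S w := by
  simp [IsTrueWitness, hw]

/-- If `w = a + u` is a key witness with aide `b + u`, then some component of a true witness
separates `a` and `b`: if `w` is not a true witness, then `a` and `b` do not differ by a unit, and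
they are separated by every maximal key witness above `w`. -/
theorem exists_isTrueWitness_not_component [AddMonoid.FG Q] {P : MonoidPrime Q} {S : Set Q}
    (hS : P.IsGeneratedBy S) {a b u : Q} (hne : bar c P (a + u) ≠ bar c P (b + u))
    (h : IsKeyAide c P S (a + u) (b + u)) :
    ∃ w, IsTrueWitness c P S w ∧ ¬ component c P w a b := by
  by_cases ht : IsTrueWitness c P S (a + u)
  · exact ⟨_, ht, not_component_of_add_ne hne⟩
  obtain ⟨hmax, hs⟩ := (not_isTrueWitness_iff ⟨_, h⟩).1 ht
  obtain ⟨y, hy, hymax, hle, -⟩ :=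
    IsKeyWitness.exists_isMaximalKeyWitness hS ⟨_, h⟩ hmax
  refine ⟨y, ⟨hy, Or.inl hymax⟩, ?_⟩
  rintro (⟨ha, -⟩ | ⟨⟨v, hv⟩, -⟩)
  · exact ha (GreenLE.trans ⟨bar c P u, map_add _ _ _⟩ hle)
  · refine h.ne_add_addUnit hS hne hs v ?_
    rw [map_add, hv, map_add]
    abel

/-- An aide `q` of a key witness `w` that is not a true witness is not a multiple of `w`: neither by
a unit, as `w` is suspicious, nor by an element of `P_P`, as `w` is not maximal. Hence `w` is in turn
an aide of `q`. -/
theorem IsKeyAide.symm_of_not_isTrueWitness {P : MonoidPrime Q} {S : Set Q} {w q : Q}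
    (hS : P.IsGeneratedBy S) (h : IsKeyAide c P S w q) (hne : bar c P w ≠ bar c P q)
    (hmax : ¬ IsMaximalKeyWitness c P S w) (hs : IsSuspicious c P S w) :
    ¬ GreenLE (bar c P w) (bar c P q) ∧ IsKeyAide c P S q w := by
  have hnle : ¬ GreenLE (bar c P w) (bar c P q) := by
    rintro ⟨x, hx⟩
    rcases exists_addUnit_or_mem x with ⟨g, rfl⟩ | ⟨p, hp, y, rfl⟩
    · exact h.ne_add_addUnit hS hne hs (AddUnits.map (locCon c P).mk' g) hx
    · refine hmax ⟨⟨w, ⟨q, h⟩, rfl⟩, ?_⟩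
      rintro _ ⟨w', hw', rfl⟩ hle
      exact h.greenLE_of_isKeyWitness hS hp hx hw' hle
  refine ⟨hnle, fun p hp => ⟨hne.symm, (h p hp).2.1.symm, by simp, ?_⟩⟩
  rintro _ (rfl | rfl)
  exacts [id, fun h' => absurd h' hnle]

/-- If `a + u` is a key witness with aide `b + u`, then `a` and `b` are separated by a component of
a key witness other than that of any given `w` that is not a true witness. The component of `b + u`
replaces that of `a + u` if the latter is the excluded one. -/
theorem exists_keyComponents_not_rel (gen : MonoidPrime Q → Set Q)
    (hgen : ∀ P : MonoidPrime Q, P.IsGeneratedBy (gen P)) {P : MonoidPrime Q} {w : Q}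
    (hw : IsKeyWitness c P (gen P) w) (ht : ¬ IsTrueWitness c P (gen P) w)
    {P' : MonoidPrime Q} {a b u : Q} (hne : bar c P' (a + u) ≠ bar c P' (b + u))
    (h : IsKeyAide c P' (gen P') (a + u) (b + u)) :
    ∃ D ∈ keyComponents c gen \ {component c P w}, ¬ D a b := by
  by_cases heq : component c P' (a + u) = component c P w
  · obtain ⟨rfl, hiff⟩ :=
      eq_and_greenLE_iff_of_component_eq (hgen P') (hgen P) ⟨_, h⟩ hw heq
    have hle := (hiff (a + u)).1 (GreenLE.refl _)
    have hge := (hiff w).2 (GreenLE.refl _)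
    obtain ⟨hmax, hs⟩ := (not_isTrueWitness_iff hw).1 ht
    obtain ⟨hnle, h'⟩ := h.symm_of_not_isTrueWitness (hgen P') hne
      (fun hm => hmax (hm.of_greenLE hw hle)) (hs.of_greenLE hge hle)
    refine ⟨component c P' (b + u), ⟨⟨P', _, ⟨_, h'⟩, rfl⟩, fun heq' => ?_⟩,
      fun hr => not_component_of_add_ne hne.symm ((component c P' (b + u)).symm hr)⟩
    obtain ⟨-, hiff'⟩ := eq_and_greenLE_iff_of_component_eq (hgen P') (hgen P') ⟨_, h'⟩
      ⟨_, h⟩ (Eq.trans heq' heq.symm)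
    exact hnle ((hiff' (a + u)).2 (GreenLE.refl _))
  · exact ⟨_, ⟨⟨P', _, ⟨_, h⟩, rfl⟩, heq⟩, not_component_of_add_ne hne⟩

/-- A set of congruences containing `c` has intersection `c` if it separates inequivalent
elements. -/
theorem sInf_eq_of_separates {T : Set (AddCon Q)} (hle : ∀ D ∈ T, c ≤ D)
    (hsep : ∀ a b, ¬ c a b → ∃ D ∈ T, ¬ D a b) : sInf T = c := by
  refine le_antisymm (fun a b hab => ?_) (le_sInf hle)
  by_contra hn
  obtain ⟨D, hD, hnD⟩ := hsep a b hn
  exact hnD (sInf_le hD hab)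

end Decomposition

end Mesoprimary

open Mesoprimary in
theorem theorem3p7 {Q : Type*} [AddCommMonoid Q] [AddMonoid.FG Q]
    (gen : MonoidPrime Q → Set Q) (hgen : ∀ P : MonoidPrime Q, P.IsGeneratedBy (gen P))
    (c : AddCon Q) :
    sInf (trueComponents c gen) = c ∧
      ∀ (P : MonoidPrime Q) (w : Q),
        IsKeyWitness c P (gen P) w → ¬ IsTrueWitness c P (gen P) w →
          sInf (keyComponents c gen \ {component c P w}) = c := by
  refine ⟨sInf_eq_of_separates ?_ fun a b hab => ?_, fun P w hw ht =>
    sInf_eq_of_separates ?_ fun a b hab => ?_⟩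
  · rintro _ ⟨P, w, -, rfl⟩
    exact le_component P w
  · obtain ⟨P, u, hne, h | h⟩ := exists_isKeyAide gen hgen hab
    · obtain ⟨w, hw, hn⟩ := exists_isTrueWitness_not_component (hgen P) hne h
      exact ⟨_, ⟨P, w, hw, rfl⟩, hn⟩
    · obtain ⟨w, hw, hn⟩ := exists_isTrueWitness_not_component (hgen P) hne.symm h
      exact ⟨_, ⟨P, w, hw, rfl⟩, fun hr => hn ((component c P w).symm hr)⟩
  · rintro _ ⟨⟨P', w', -, rfl⟩, -⟩
    exact le_component P' w'
  · obtain ⟨P', u, hne, h | h⟩ := exists_isKeyAide gen hgen hab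
    · exact exists_keyComponents_not_rel gen hgen hw ht hne h
    · obtain ⟨D, hD, hn⟩ := exists_keyComponents_not_rel gen hgen hw ht hne.symm h
      exact ⟨D, hD, fun hr => hn (D.symm hr)⟩
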